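/- Let $\mathcal X$ be a feature space, $\mathcal Y=\{-1,+1\}$, and let $G$ be a (directed) manipulation graph on $\mathcal X$ with closed neighbourhoods $N_G[x]=\{x\}\cup\{x' : (x,x')\in E(G)\}$. An agent $(x,y)\in\mathcal X\times\mathcal Y$ facing a classifier $h:\mathcal X\to\mathcal Y$ moves to $z$, where $z=x$ if $h(x)=+1$ or if no $x'\in N_G[x]$ has $h(x')=+1$, and otherwise $z\in N_G[x]$ with $h(z)=+1$ is chosen by a fixed tie-breaking rule; the strategic loss is $\ell(h,(x,y))=\mathbf 1\{h(z)\neq y\}$. In each round $t=1,\dots,T$ the learner picks a distribution over classifiers as a function of its past observations $(h_s,z_s,y_s)_{s<t}$, an adaptive adversary picks an agent $(x_t,y_t)$ as a function of all past rounds $(h_s,x_s,y_s)_{s<t}$, the learner samples $h_t$ from its distribution, and it then observes the manipulated feature $z_t$ and the label $y_t$. The expected Stackelberg regret with respect to $\mathcal H$ is $\max_{h\in\mathcal H}\sum_{t=1}^T\mathbb E[\ell(h_t,(x_t,y_t))-\ell(h,(x_t,y_t))]$, the expectation being over the learner's sampling. **Theorem.** There is an absolute constant $C>0$ such that for every $\mathcal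 X$, every manipulation graph $G$ on $\mathcal X$, every finite nonempty class $\mathcal H=\{h^1,\dots,h^n\}\subseteq\mathcal Y^{\mathcal X}$ of size $n$, and every horizon $T\ge 1$, there is a proper learner (it only plays classifiers in $\mathcal H$) whose expected Stackelberg regret is at most $$C\left(\sqrt{T\log n}+n\log(nT)\right)$$ for every tie-breaking rule and against every adaptive adversary. Moreover, the learner can be taken to be the following algorithm. With $\varepsilon=1/(nT)$, $\eta=\sqrt{\log n/T}$, $\nu=1/16$ and $\Delta_{n,\varepsilon}=\{p\in\mathbb R^n:\sum_i p(i)=1,\ p(i)\ge\varepsilon \text{ for all } i\}$, in round $t$ it plays $h^i$ with probability $p_t(i)$, where $$p_t\in\arg\min_{p\in\Delta_{n,\varepsilon}}\Big\{\sum_{s<t}\langle\widehat d_s,p\rangle+\frac1\eta\sum_{i=1}^n p(i)\log p(i)-\frac1\nu\sum_{i=1}^n\log p(i)\Big\},$$ $$\widehat d_s(i)=\mathbf 1\{h_s\in R_s\}\,\mathbf 1\{h^i\in R_s\}\,\frac{y_s}{\sum_{j:h^j\in R_s}p_s(j)},\qquad R_s=\{h\in\mathcal H : h(x')=-1\ \text{for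 all } x'\in N_G[x_s]\}.$$ The estimate $\widehat d_s$ is a function of what the learner observes, because $h_s\in R_s$ if and only if $h_s(z_s)=-1$, and then $z_s=x_s$. (For $n=1$, where $\eta=0$, the set $\Delta_{1,\varepsilon}$ is a single point and the entropy term is read as $0$.) -/

import Mathlib

universe u

noncomputable section

namespace StrategicClassification

variable {X : Type u}

/-- Labels are `{-1, +1}`, realised as the units of `ℤ`. -/
abbrev Label : Type := ℤˣ

/-- A classifier on the feature space `X`. -/
abbrev Classifier (X : Type u) : Type u := X → Label

/-- An agent: its original feature vector and its true label. -/
abbrev Agent (X : Type u) : Type u := X × Label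

/-- The closed neighbourhood `N_G[x]` in the manipulation graph; an edge `G.Adj x x'` says that an
agent with feature vector `x` can manipulate to `x'`. -/
def closedNbhd (G : Digraph X) (x : X) : Set X := {x' | x' = x ∨ G.Adj x x'}

/-- The set of best responses of `x` under the classifier `h`. -/
def bestResponses (G : Digraph X) (h : Classifier X) (x : X) : Set X :=
  {x' | x' ∈ closedNbhd G x ∧ h x' = 1}

/-- A fixed tie-breaking rule: it picks a best response whenever there is one. -/
structure TieBreaking (G : Digraph X) where
  /-- the selected feature vector -/
  pick : Classifier X → X → X
  pick_mem : ∀ h x, (bestResponses G h x).Nonempty → pick h x ∈ bestResponses G h x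

open Classical in
/-- The manipulated feature vector `z` of an agent at `x` responding to `h`. -/
def manipulate {G : Digraph X} (tie : TieBreaking G) (h : Classifier X) (x : X) : X :=
  if bestResponses G h x = ∅ ∨ x ∈ bestResponses G h x then x else tie.pick h x

/-- The strategic loss: the misclassification error after manipulation. -/
def strategicLoss {G : Digraph X} (tie : TieBreaking G) (h : Classifier X) (a : Agent X) : ℝ :=
  if h (manipulate tie h a.1) ≠ a.2 then 1 else 0

/-! ### The interaction protocol -/

/-- What the learner knows about a finished round: the classifier it played, the manipulated
feature vector and the true label (but not the original feature vector). -/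
structure Observation (X : Type u) where
  /-- the classifier that was sampled -/
  hyp : Classifier X
  /-- the manipulated feature vector -/
  feature : X
  /-- the true label -/
  label : Label

/-- A finished round: the sampled classifier and the agent chosen by the adversary. -/
structure Round (X : Type u) where
  /-- the classifier that was sampled -/
  hyp : Classifier X
  /-- the agent chosen by the adversary -/
  agent : Agent X

/-- What the learner observes of a round. -/
def Round.observe {G : Digraph X} (tie : TieBreaking G) (r : Round X) : Observation X where
  hyp := r.hyp
  feature := manipulate tie r.hyp r.agent.1
  label := r.agent.2

/-- A learner maps the list of past observations (most recent first) to the distribution from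
which the next classifier is sampled. -/
abbrev Learner (X : Type u) : Type u := List (Observation X) → PMF (Classifier X)

/-- An adaptive adversary maps the full list of past rounds (most recent first) to the next
agent. -/
abbrev Adversary (X : Type u) : Type u := List (Round X) → Agent X

/-- A learner is proper for `H` if it only ever plays classifiers in `H`. -/
def Learner.IsProper (H : Finset (Classifier X)) (L : Learner X) : Prop :=
  ∀ hist, (L hist).support ⊆ (H : Set (Classifier X))

/-- The law of the transcript (most recent round first) of the first `t` rounds. In each round the
agent depends on the past only, and the classifier is sampled from the learner's distribution. -/
def transcriptLaw {G : Digraph X} (tie : TieBreaking G) (L : Learner X) (A : Adversary X) :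
    ℕ → PMF (List (Round X))
  | 0 => PMF.pure []
  | t + 1 => (transcriptLaw tie L A t).bind fun τ =>
      (L (τ.map (Round.observe tie))).map fun h => ⟨h, A τ⟩ :: τ

/-- Expectation of a real-valued function under a discrete law. -/
def expectation {α : Type*} (μ : PMF α) (f : α → ℝ) : ℝ := ∑' a, (μ a).toReal * f a

/-- The cumulative loss on a transcript in excess of that of the fixed classifier `h`. -/
def excessLoss {G : Digraph X} (tie : TieBreaking G) (h : Classifier X) (τ : List (Round X)) : ℝ :=
  (τ.map fun r => strategicLoss tie r.hyp r.agent - strategicLoss tie h r.agent).sum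

/-- The expected Stackelberg regret after `T` rounds: the maximum over `h ∈ H` of the expected
cumulative excess loss over `h`. -/
def expectedRegret {G : Digraph X} (tie : TieBreaking G) (H : Finset (Classifier X))
    (hH : H.Nonempty) (T : ℕ) (L : Learner X) (A : Adversary X) : ℝ :=
  H.sup' hH fun h => expectation (transcriptLaw tie L A T) (excessLoss tie h)

/-! ### The algorithm -/

/-- The classifiers labelling all of `N_G[x]` negatively. -/
def allNegative (G : Digraph X) (x : X) : Set (Classifier X) :=
  {h | ∀ x' ∈ closedNbhd G x, h x' = -1}

open Classical in
/-- The probability that weights `p` on `H` give to the members of `H` that label all of `N_G[x]`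
negatively. -/
def allNegativeMass (G : Digraph X) (H : Finset (Classifier X)) (p : H → ℝ) (x : X) : ℝ :=
  ∑ i : H, if i.1 ∈ allNegative G x then p i else 0

open Classical in
/-- The importance-weighted estimator of the shifted losses, computed from an observation. See
`estimator_observe` for its expression through the original feature vector. -/
def estimator (G : Digraph X) (H : Finset (Classifier X)) (p : H → ℝ) (o : Observation X)
    (i : H) : ℝ :=
  if o.hyp o.feature = -1 ∧ i.1 ∈ allNegative G o.feature then
    ((o.label : ℤ) : ℝ) / allNegativeMass G H p o.feature
  else 0

open Classical in
theorem estimator_observe {G : Digraph X} (tie : TieBreaking G) (H : Finset (Classifier X))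
    (p : H → ℝ) (r : Round X) (i : H) :
    estimator G H p (r.observe tie) i =
      (if r.hyp ∈ allNegative G r.agent.1 then 1 else 0) *
        (if i.1 ∈ allNegative G r.agent.1 then 1 else 0) *
        (((r.agent.2 : ℤ) : ℝ) / allNegativeMass G H p r.agent.1) := by
  have hne : (1 : Label) ≠ -1 := by decide
  obtain ⟨h, x, y⟩ := r
  simp only [estimator, Round.observe]
  by_cases hR : h ∈ allNegative G x
  · have hempty : bestResponses G h x = ∅ := by
      ext x'
      simp only [bestResponses, Set.mem_ofPred_eq, Set.mem_empty_iff_false, iff_false, not_and]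
      intro hx' h1
      exact hne (h1.symm.trans (hR x' hx'))
    have hz : manipulate tie h x = x := by simp [manipulate, hempty]
    have hx : h x = -1 := hR x (Or.inl rfl)
    simp [hz, hx, hR]
  · have hz : h (manipulate tie h x) = 1 := by
      have hne' : (bestResponses G h x).Nonempty := by
        simp only [allNegative, Set.mem_ofPred_eq, not_forall] at hR
        obtain ⟨x', hx', h1⟩ := hR
        exact ⟨x', hx', (Int.units_eq_one_or (h x')).resolve_right h1⟩
      unfold manipulate
      split_ifs with hc
      · rcases hc with hc | hc
        · exact absurd hc hne'.ne_empty
        · exact hc.2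
      · exact (tie.pick_mem h x hne').2
    simp [hz, hne, hR]

/-- The probabilities with which the learner plays the members of `H` after a given history. -/
def Learner.weights (L : Learner X) (H : Finset (Classifier X)) (hist : List (Observation X)) :
    H → ℝ :=
  fun i => (L hist i.1).toReal

/-- The sum of the loss estimates over a history (most recent observation first); the estimate of
a round uses the probabilities the learner used in that round. -/
def cumulativeEstimate (G : Digraph X) (H : Finset (Classifier X)) (L : Learner X) :
    List (Observation X) → H → ℝ
  | [] => 0
  | o :: hist => cumulativeEstimate G H L hist + estimator G H (L.weights H hist) o

/-- The `ε`-shrunk probability simplex. -/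
def shrunkSimplex (ι : Type*) [Fintype ι] (ε : ℝ) : Set (ι → ℝ) :=
  {p | p ∈ stdSimplex ℝ ι ∧ ∀ i, ε ≤ p i}

/-- The entropy plus log-barrier regularizer. -/
def regularizer {ι : Type*} [Fintype ι] (η ν : ℝ) (p : ι → ℝ) : ℝ :=
  1 / η * ∑ i, p i * Real.log (p i) - 1 / ν * ∑ i, Real.log (p i)

/-- `L` is follow-the-regularized-leader on `H` with parameters `ε`, `η`, `ν`: after every history
its probabilities minimize the cumulative loss estimate plus the regularizer over the
`ε`-shrunk simplex. -/
def Learner.IsFTRL (G : Digraph X) (H : Finset (Classifier X)) (ε η ν : ℝ) (L : Learner X) :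
    Prop :=
  ∀ hist, L.weights H hist ∈ shrunkSimplex H ε ∧
    IsMinOn (fun p : H → ℝ => (∑ i, cumulativeEstimate G H L hist i * p i) + regularizer η ν p)
      (shrunkSimplex H ε) (L.weights H hist)

end StrategicClassification

end

/-!
Shifting the loss of a round by `1` when the label is `-1` leaves the regret unchanged. The shifted
loss of a classifier is the label `±1` if the classifier labels the whole neighbourhood of the agent
negatively, and `0` otherwise, so dividing by the probability of observing it gives an unbiased
estimator.

The proof follows a potential: the excess loss so far plus the gap, in the regularized cumulative
estimate, between a comparator and the current minimizer. By the first-order optimality condition a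
round that moves the minimizer from `p` to `q` adds in expectation at most the decrease of the
estimate from `p` to `q`, less the Bregman divergence of the regularizer, up to replacing the
competitor by the comparator. Jensen's inequality reduces this trade-off to the ratio `Q / P` of the
masses that `q` and `p` give to the all-negative classifiers. Importance weights are unbounded, so
the entropy alone does not suffice: it controls ratios up to `4`, at a cost `9η / (4P)`, and the
log-barrier controls the larger ones for free. As the estimate vanishes with probability `1 - P`,
the expected cost is only `9η / 4`. Smoothing the comparator into the shrunk simplex costs `nε`
more per round, and the initial gap is at most `log n / η + n log (1 / ε) / ν`.
-/

noncomputable section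

namespace StrategicClassification

open Finset InformationTheory

/-! ### The entropy and log-barrier divergences -/

/-- The Itakura–Saito function, generating the Bregman divergence of the log-barrier in the way
`klFun` generates that of the entropy. -/
def itakuraSaitoFun (r : ℝ) : ℝ := r - 1 - Real.log r

lemma itakuraSaitoFun_nonneg {r : ℝ} (hr : 0 < r) : 0 ≤ itakuraSaitoFun r :=
  sub_nonneg.2 (Real.log_le_sub_one_of_pos hr)

lemma convexOn_itakuraSaitoFun : ConvexOn ℝ (Set.Ioi 0) itakuraSaitoFun :=
  ((convexOn_id (convex_Ioi 0)).sub (concaveOn_const 1 (convex_Ioi 0))).sub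
    strictConcaveOn_log_Ioi.concaveOn

lemma sub_one_le_two_mul_itakuraSaitoFun {r : ℝ} (hr : 4 ≤ r) :
    r - 1 ≤ 2 * itakuraSaitoFun r := by
  have hlog_four : Real.log 4 = 2 * Real.log 2 := by
    rw [show (4 : ℝ) = 2 ^ 2 by norm_num, Real.log_pow, Nat.cast_ofNat]
  have htangent := Real.log_le_sub_one_of_pos (show 0 < r / 4 by linarith)
  rw [Real.log_div (by linarith) (by norm_num), hlog_four] at htangent
  rw [itakuraSaitoFun]
  linarith [Real.log_two_lt_d9]

lemma sq_sqrt_sub_one_le_klFun {r : ℝ} (hr : 0 < r) : (√r - 1) ^ 2 ≤ klFun r := by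
  have hsqrt : 0 < √r := Real.sqrt_pos.2 hr
  have hlog : 1 - (√r)⁻¹ ≤ Real.log r / 2 :=
    Real.log_sqrt hr.le ▸ Real.one_sub_inv_le_log_of_pos hsqrt
  calc (√r - 1) ^ 2 = r * (2 * (1 - (√r)⁻¹)) + 1 - r := by
        linear_combination Real.sq_sqrt hr.le + 2 * Real.div_sqrt (x := r)
    _ ≤ r * Real.log r + 1 - r := by gcongr; linarith

lemma abs_sub_one_le_mul_klFun {r a : ℝ} (hr : 0 < r) (hr4 : r ≤ 4) (ha : 0 < a) :
    |r - 1| ≤ a * klFun r + 9 / (4 * a) := by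
  have hsqrt : √r ≤ 2 := Real.sqrt_le_iff.2 ⟨by norm_num, by linarith⟩
  calc |r - 1| = |√r - 1| * (√r + 1) := by
        rw [← abs_of_pos (show 0 < √r + 1 by positivity), ← abs_mul]
        congr 1
        nlinarith [Real.sq_sqrt hr.le]
    _ ≤ |√r - 1| * 3 := by gcongr; linarith
    _ ≤ a * |√r - 1| ^ 2 + 9 / (4 * a) := by
        rw [← sub_nonneg]
        convert (show 0 ≤ (2 * a * |√r - 1| - 3) ^ 2 / (4 * a) by positivity) using 1
        field_simp
        ring
    _ ≤ a * klFun r + 9 / (4 * a) := by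
        rw [sq_abs]
        gcongr
        exact sq_sqrt_sub_one_le_klFun hr

/-- For ratios up to `4` the entropy is quadratic; beyond, it is the barrier that pays for `y`,
with no price in `a`. -/
lemma mul_one_sub_le_klFun_add_itakuraSaitoFun {r a b y : ℝ} (hr : 0 < r) (ha : 0 < a)
    (hb : 2 ≤ b) (hy : |y| ≤ 1) :
    y * (1 - r) ≤ a * klFun r + b * itakuraSaitoFun r + 9 / (4 * a) := by
  have habs : y * (1 - r) ≤ |r - 1| := by
    rw [abs_sub_comm]
    exact (le_abs_self _).trans (abs_mul y _ ▸ mul_le_of_le_one_left (abs_nonneg _) hy)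
  have hkl : 0 ≤ a * klFun r := mul_nonneg ha.le (klFun_nonneg hr.le)
  have hbarrier : 2 * itakuraSaitoFun r ≤ b * itakuraSaitoFun r :=
    mul_le_mul_of_nonneg_right hb (itakuraSaitoFun_nonneg hr)
  refine habs.trans ?_
  rcases le_total r 4 with hr4 | hr4
  · linarith [abs_sub_one_le_mul_klFun hr hr4 ha, itakuraSaitoFun_nonneg hr]
  · have : 0 ≤ 9 / (4 * a) := by positivity
    rw [abs_of_nonneg (by linarith)]
    linarith [sub_one_le_two_mul_itakuraSaitoFun hr4]

section Regularizer

variable {ι : Type*}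

lemma sum_mul_map_div_sum_le {f : ℝ → ℝ} {s : Set ℝ} (hf : ConvexOn ℝ s f) {R : Finset ι}
    (hR : R.Nonempty) {p q : ι → ℝ} (hp : ∀ i ∈ R, 0 < p i) (hq : ∀ i ∈ R, q i / p i ∈ s) :
    (∑ i ∈ R, p i) * f ((∑ i ∈ R, q i) / ∑ i ∈ R, p i) ≤ ∑ i ∈ R, p i * f (q i / p i) := by
  have hP : 0 < ∑ i ∈ R, p i := sum_pos hp hR
  have hJensen := hf.map_centerMass_le (fun i hi => (hp i hi).le) hP hq
  have hmean : R.centerMass p (fun i => q i / p i) = (∑ i ∈ R, q i) / ∑ i ∈ R, p i := by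
    rw [centerMass, smul_eq_mul, inv_mul_eq_div]
    exact congrArg (· / _) (sum_congr rfl fun i hi => mul_div_cancel₀ _ (hp i hi).ne')
  rw [hmean, centerMass, smul_eq_mul, inv_mul_eq_div, le_div_iff₀' hP] at hJensen
  exact hJensen

variable [Fintype ι]

/-- The gradient of `regularizer η ν` at a point with nonzero coordinates. -/
def regularizerGrad (η ν : ℝ) (p : ι → ℝ) (i : ι) : ℝ :=
  1 / η * (Real.log (p i) + 1) - 1 / ν * (p i)⁻¹

lemma hasFDerivAt_regularizer (η ν : ℝ) {p : ι → ℝ} (hp : ∀ i, p i ≠ 0) :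
    HasFDerivAt (regularizer η ν)
      (∑ i, regularizerGrad η ν p i • (ContinuousLinearMap.proj i : (ι → ℝ) →L[ℝ] ℝ)) p := by
  have hcoord (i : ι) := (ContinuousLinearMap.proj i : (ι → ℝ) →L[ℝ] ℝ).hasFDerivAt (x := p)
  have hentropy := HasFDerivAt.fun_sum (u := univ) fun i _ =>
    (Real.hasDerivAt_mul_log (hp i)).comp_hasFDerivAt p (hcoord i)
  have hbarrier := HasFDerivAt.fun_sum (u := univ) fun i _ =>
    (Real.hasDerivAt_log (hp i)).comp_hasFDerivAt p (hcoord i)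
  refine ((hentropy.const_mul (1 / η)).sub (hbarrier.const_mul (1 / ν))).congr_fderiv ?_
  simp only [smul_sum, smul_smul, ← sum_sub_distrib, ← sub_smul, regularizerGrad]

/-- The Bregman divergence of `regularizer η ν`, linearized at its second argument `p`. It measures
by how much the objective grows away from its minimizer. -/
def regularizerBregman (η ν : ℝ) (q p : ι → ℝ) : ℝ :=
  regularizer η ν q - regularizer η ν p - regularizerGrad η ν p ⬝ᵥ (q - p)

lemma regularizerBregman_eq (η ν : ℝ) {p q : ι → ℝ} (hp : ∀ i, 0 < p i) (hq : ∀ i, 0 < q i) :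
    regularizerBregman η ν q p =
      1 / η * ∑ i, p i * klFun (q i / p i) + 1 / ν * ∑ i, itakuraSaitoFun (q i / p i) := by
  simp only [regularizerBregman, regularizer, dotProduct, mul_sum, ← sum_sub_distrib,
    ← sum_add_distrib]
  refine sum_congr rfl fun i _ => ?_
  have := (hp i).ne'
  simp only [regularizerGrad, Pi.sub_apply, klFun_apply, itakuraSaitoFun,
    Real.log_div (hq i).ne' this]
  generalize Real.log (q i) = lq, Real.log (p i) = lp, 1 / η = a, 1 / ν = b
  field_simp
  ring

lemma regularizerBregman_nonneg {η ν : ℝ} (hη : 0 ≤ η) (hν : 0 ≤ ν) {p q : ι → ℝ}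
    (hp : ∀ i, 0 < p i) (hq : ∀ i, 0 < q i) : 0 ≤ regularizerBregman η ν q p := by
  have hratio (i : ι) : 0 < q i / p i := div_pos (hq i) (hp i)
  rw [regularizerBregman_eq η ν hp hq]
  exact add_nonneg
    (mul_nonneg (by positivity) (sum_nonneg fun i _ =>
      mul_nonneg (hp i).le (klFun_nonneg (hratio i).le)))
    (mul_nonneg (by positivity) (sum_nonneg fun i _ => itakuraSaitoFun_nonneg (hratio i)))

theorem add_regularizerBregman_le_of_isMinOn {η ν : ℝ} {c p q : ι → ℝ} {s : Set (ι → ℝ)}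
    (hs : Convex ℝ s) (hp : p ∈ s) (hq : q ∈ s) (hp₀ : ∀ i, p i ≠ 0)
    (hmin : IsMinOn (fun v => c ⬝ᵥ v + regularizer η ν v) s p) :
    c ⬝ᵥ p + regularizer η ν p + regularizerBregman η ν q p ≤ c ⬝ᵥ q + regularizer η ν q := by
  have hlinear : HasFDerivAt (fun v => c ⬝ᵥ v)
      (∑ i, c i • (ContinuousLinearMap.proj i : (ι → ℝ) →L[ℝ] ℝ)) p :=
    HasFDerivAt.fun_sum fun i _ => (hasFDerivAt_apply i p).const_mul (c i)
  have hoptimal := hmin.localize.hasFDerivWithinAt_nonneg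
    (hlinear.add (hasFDerivAt_regularizer η ν hp₀)).hasFDerivWithinAt
    (sub_mem_posTangentConeAt_of_segment_subset (hs.segment_subset hp hq))
  have hfirst_order : 0 ≤ c ⬝ᵥ (q - p) + regularizerGrad η ν p ⬝ᵥ (q - p) := by
    simpa [dotProduct] using hoptimal
  rw [dotProduct_sub] at hfirst_order
  rw [regularizerBregman]
  linarith

theorem stability_le_regularizerBregman {η ν : ℝ} (hη : 0 < η) (hν : 0 < ν) (hν' : ν ≤ 1 / 2)
    {p q : ι → ℝ} (hp : ∀ i, 0 < p i) (hq : ∀ i, 0 < q i) {R : Finset ι} (hR : R.Nonempty)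
    {y : ℝ} (hy : |y| ≤ 1) :
    y / (∑ i ∈ R, p i) * (∑ i ∈ R, p i - ∑ i ∈ R, q i) ≤
      regularizerBregman η ν q p + 9 / 4 * η / ∑ i ∈ R, p i := by
  have hratio (i : ι) : 0 < q i / p i := div_pos (hq i) (hp i)
  set P := ∑ i ∈ R, p i
  set Q := ∑ i ∈ R, q i
  have hP : 0 < P := sum_pos (fun i _ => hp i) hR
  have hQ : 0 < Q := sum_pos (fun i _ => hq i) hR
  have hentropy : P * klFun (Q / P) ≤ ∑ i, p i * klFun (q i / p i) :=
    (sum_mul_map_div_sum_le convexOn_klFun hR (fun i _ => hp i) fun i _ => (hratio i).le).trans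
      (sum_le_univ_sum_of_nonneg fun i => mul_nonneg (hp i).le (klFun_nonneg (hratio i).le))
  have hbarrier : itakuraSaitoFun (Q / P) ≤ ∑ i, itakuraSaitoFun (q i / p i) := by
    refine le_of_mul_le_mul_left ?_ hP
    calc P * itakuraSaitoFun (Q / P) ≤ ∑ i ∈ R, p i * itakuraSaitoFun (q i / p i) :=
          sum_mul_map_div_sum_le convexOn_itakuraSaitoFun hR (fun i _ => hp i)
            fun i _ => hratio i
      _ ≤ ∑ i ∈ R, P * itakuraSaitoFun (q i / p i) := sum_le_sum fun i hi =>
          mul_le_mul_of_nonneg_right (single_le_sum (fun j _ => (hp j).le) hi)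
            (itakuraSaitoFun_nonneg (hratio i))
      _ ≤ ∑ i, P * itakuraSaitoFun (q i / p i) := sum_le_univ_sum_of_nonneg fun i =>
          mul_nonneg hP.le (itakuraSaitoFun_nonneg (hratio i))
      _ = P * ∑ i, itakuraSaitoFun (q i / p i) := (mul_sum ..).symm
  calc y / P * (P - Q) = y * (1 - Q / P) := by field_simp
    _ ≤ P / η * klFun (Q / P) + 1 / ν * itakuraSaitoFun (Q / P) + 9 / (4 * (P / η)) :=
        mul_one_sub_le_klFun_add_itakuraSaitoFun (div_pos hQ hP) (div_pos hP hη)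
          ((le_one_div two_pos hν).2 hν') hy
    _ = 1 / η * (P * klFun (Q / P)) + 1 / ν * itakuraSaitoFun (Q / P) + 9 / 4 * η / P := by
        field_simp
    _ ≤ regularizerBregman η ν q p + 9 / 4 * η / P := by
        rw [regularizerBregman_eq η ν hp hq]
        gcongr

end Regularizer

/-! ### The shrunk simplex -/

section ShrunkSimplex

variable {ι : Type*} [Fintype ι] {ε : ℝ}

lemma shrunkSimplex_eq_inter_Ici (ε : ℝ) :
    shrunkSimplex ι ε = stdSimplex ℝ ι ∩ Set.Ici fun _ => ε := rfl

lemma convex_shrunkSimplex (ε : ℝ) : Convex ℝ (shrunkSimplex ι ε) :=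
  shrunkSimplex_eq_inter_Ici (ι := ι) ε ▸ (convex_stdSimplex ℝ ι).inter (convex_Ici _)

lemma isCompact_shrunkSimplex (ε : ℝ) : IsCompact (shrunkSimplex ι ε) :=
  shrunkSimplex_eq_inter_Ici (ι := ι) ε ▸ (isCompact_stdSimplex ℝ ι).inter_right isClosed_Ici

lemma pos_of_mem_shrunkSimplex (hε : 0 < ε) {p : ι → ℝ} (hp : p ∈ shrunkSimplex ι ε) (i : ι) :
    0 < p i :=
  hε.trans_le (hp.2 i)

lemma continuousOn_regularizer (hε : 0 < ε) (η ν : ℝ) :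
    ContinuousOn (regularizer η ν) (shrunkSimplex ι ε) := fun _ hp =>
  (hasFDerivAt_regularizer η ν fun i =>
    (pos_of_mem_shrunkSimplex hε hp i).ne').continuousAt.continuousWithinAt

lemma exists_isMinOn_dotProduct_add_regularizer (hε : 0 < ε)
    (hne : (shrunkSimplex ι ε).Nonempty) (η ν : ℝ) (c : ι → ℝ) :
    ∃ p ∈ shrunkSimplex ι ε,
      IsMinOn (fun v => c ⬝ᵥ v + regularizer η ν v) (shrunkSimplex ι ε) p :=
  (isCompact_shrunkSimplex ε).exists_isMinOn hne <|
    (continuous_const.dotProduct continuous_id).continuousOn.add (continuousOn_regularizer hε η ν)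

lemma sum_mul_log_nonpos {p : ι → ℝ} (hp : p ∈ stdSimplex ℝ ι) :
    ∑ i, p i * Real.log (p i) ≤ 0 :=
  sum_nonpos fun i _ => Real.mul_log_nonpos (hp.1 i) (mem_Icc_of_mem_stdSimplex hp i).2

lemma neg_log_card_le_sum_mul_log {p : ι → ℝ} (hp : p ∈ stdSimplex ℝ ι) :
    -Real.log (Fintype.card ι) ≤ ∑ i, p i * Real.log (p i) := by
  have hne : (univ : Finset ι).Nonempty := nonempty_of_sum_ne_zero (hp.2.trans_ne one_ne_zero)
  have hcard : (Fintype.card ι : ℝ) ≠ 0 := Nat.cast_ne_zero.2 hne.card_ne_zero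
  have hJensen := sum_mul_map_div_sum_le Real.convexOn_mul_log hne (p := 1) (q := p)
    (fun _ _ => one_pos) (fun i _ => by simpa using hp.1 i)
  simpa [hp.2, hcard] using hJensen

lemma sum_log_nonpos {p : ι → ℝ} (hp : p ∈ stdSimplex ℝ ι) : ∑ i, Real.log (p i) ≤ 0 :=
  sum_nonpos fun i _ => Real.log_nonpos (hp.1 i) (mem_Icc_of_mem_stdSimplex hp i).2

lemma card_mul_log_le_sum_log (hε : 0 < ε) {p : ι → ℝ} (hp : ∀ i, ε ≤ p i) :
    Fintype.card ι * Real.log ε ≤ ∑ i, Real.log (p i) := by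
  simpa using card_nsmul_le_sum univ _ _ fun i _ => Real.log_le_log hε (hp i)

theorem regularizer_sub_regularizer_le (hε : 0 < ε) {η ν : ℝ} (hη : 0 ≤ η) (hν : 0 ≤ ν)
    {p q : ι → ℝ} (hp : p ∈ stdSimplex ℝ ι) (hq : q ∈ shrunkSimplex ι ε) :
    regularizer η ν q - regularizer η ν p ≤
      1 / η * Real.log (Fintype.card ι) + 1 / ν * (Fintype.card ι * Real.log (1 / ε)) := by
  have hentropy : ∑ i, q i * Real.log (q i) - ∑ i, p i * Real.log (p i) ≤
      Real.log (Fintype.card ι) := by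
    linarith [sum_mul_log_nonpos hq.1, neg_log_card_le_sum_mul_log hp]
  have hbarrier : ∑ i, Real.log (p i) - ∑ i, Real.log (q i) ≤
      Fintype.card ι * Real.log (1 / ε) := by
    rw [one_div, Real.log_inv]
    linarith [sum_log_nonpos hp, card_mul_log_le_sum_log hε hq.2]
  calc regularizer η ν q - regularizer η ν p
      = 1 / η * (∑ i, q i * Real.log (q i) - ∑ i, p i * Real.log (p i)) +
          1 / ν * (∑ i, Real.log (p i) - ∑ i, Real.log (q i)) := by
        simp only [regularizer]
        ring
    _ ≤ _ := by gcongr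

section SmoothedVertex

variable [DecidableEq ι]

/-- The vertex `k` of the simplex moved into `shrunkSimplex ι ε`: a comparator that the learner
is allowed to play, standing in for `k`. -/
def smoothedVertex (ε : ℝ) (k : ι) : ι → ℝ := fun i =>
  (1 - Fintype.card ι * ε) * (if i = k then 1 else 0) + ε

lemma smoothedVertex_mem_shrunkSimplex (hε : 0 ≤ ε) (hε' : Fintype.card ι * ε ≤ 1) (k : ι) :
    smoothedVertex ε k ∈ shrunkSimplex ι ε := by
  have hge (i : ι) : ε ≤ smoothedVertex ε k i :=
    le_add_of_nonneg_left (mul_nonneg (sub_nonneg.2 hε') (by positivity))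
  refine ⟨⟨fun i => hε.trans (hge i), ?_⟩, hge⟩
  simp [smoothedVertex, sum_add_distrib]

lemma dotProduct_smoothedVertex (c : ι → ℝ) (k : ι) :
    c ⬝ᵥ smoothedVertex ε k = c k + ε * ∑ i, (c i - c k) := by
  simp only [dotProduct, smoothedVertex, mul_add, sum_add_distrib, sum_sub_distrib, sum_const,
    card_univ, nsmul_eq_mul, ← sum_mul, mul_ite, mul_one, mul_zero, sum_ite_eq', mem_univ, if_true]
  ring

lemma dotProduct_smoothedVertex_le (hε : 0 ≤ ε) {c : ι → ℝ} {k : ι}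
    (hc : ∀ i, c i - c k ≤ 1) : c ⬝ᵥ smoothedVertex ε k ≤ c k + Fintype.card ι * ε := by
  rw [dotProduct_smoothedVertex, mul_comm _ ε]
  gcongr
  simpa using sum_le_card_nsmul univ _ 1 fun i _ => hc i

end SmoothedVertex

lemma shrunkSimplex_nonempty [Nonempty ι] (hε : 0 ≤ ε) (hε' : Fintype.card ι * ε ≤ 1) :
    (shrunkSimplex ι ε).Nonempty := by
  classical
  exact ⟨_, smoothedVertex_mem_shrunkSimplex hε hε' (Classical.arbitrary ι)⟩

end ShrunkSimplex

/-! ### Expectations under laws of finite support -/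

section Expectation

variable {α β : Type*}

lemma sum_toReal_eq_one_iff (μ : PMF α) (S : Finset α) :
    ∑ a ∈ S, (μ a).toReal = 1 ↔ μ.support ⊆ S := by
  rw [← PMF.toOuterMeasure_apply_eq_one_iff, PMF.toOuterMeasure_apply_finset,
    ← ENNReal.toReal_sum fun a _ => μ.apply_ne_top a, ENNReal.toReal_eq_one_iff]

lemma expectation_eq_sum (μ : PMF α) (f : α → ℝ) {S : Finset α} (hS : μ.support ⊆ S) :
    expectation μ f = ∑ a ∈ S, (μ a).toReal * f a :=
  tsum_eq_sum fun a ha => by simp [(μ.apply_eq_zero_iff a).2 fun h => ha (hS h)]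

lemma expectation_pure (a : α) (f : α → ℝ) : expectation (PMF.pure a) f = f a := by
  rw [expectation_eq_sum _ f (S := {a}) (by simp [PMF.support_pure])]
  simp

lemma expectation_mono {μ : PMF α} (hμ : μ.support.Finite) {f g : α → ℝ} (hfg : ∀ a, f a ≤ g a) :
    expectation μ f ≤ expectation μ g := by
  have hS := hμ.coe_toFinset.ge
  rw [expectation_eq_sum _ f hS, expectation_eq_sum _ g hS]
  gcongr with a
  exact hfg a

lemma expectation_add_const {μ : PMF α} (hμ : μ.support.Finite) (f : α → ℝ) (c : ℝ) :
    (expectation μ fun a => f a + c) = expectation μ f + c := by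
  have hS := hμ.coe_toFinset.ge
  rw [expectation_eq_sum _ f hS, expectation_eq_sum _ _ hS]
  simp only [mul_add, sum_add_distrib, ← sum_mul, (sum_toReal_eq_one_iff μ _).2 hS, one_mul]

lemma toReal_bind_apply {μ : PMF α} {S : Finset α} (hS : μ.support ⊆ S) (κ : α → PMF β) (b : β) :
    (μ.bind κ b).toReal = ∑ a ∈ S, (μ a).toReal * (κ a b).toReal := by
  rw [PMF.bind_apply, tsum_eq_sum (s := S), ENNReal.toReal_sum]
  · simp only [ENNReal.toReal_mul]
  · exact fun a _ => ENNReal.mul_ne_top (μ.apply_ne_top a) ((κ a).apply_ne_top b)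
  · exact fun a ha => by simp [(μ.apply_eq_zero_iff a).2 fun h => ha (hS h)]

lemma expectation_bind {μ : PMF α} (hμ : μ.support.Finite) {κ : α → PMF β}
    (hκ : ∀ a, (κ a).support.Finite) (f : β → ℝ) :
    expectation (μ.bind κ) f = expectation μ fun a => expectation (κ a) f := by
  have hS := hμ.coe_toFinset.ge
  have hfin : (μ.bind κ).support.Finite :=
    PMF.support_bind μ κ ▸ hμ.biUnion fun a _ => hκ a
  have hκU {a : α} (ha : a ∈ hμ.toFinset) : (κ a).support ⊆ hfin.toFinset := fun b hb =>
    hfin.mem_toFinset.2 ((PMF.mem_support_bind_iff ..).2 ⟨a, hμ.mem_toFinset.1 ha, hb⟩)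
  calc expectation (μ.bind κ) f
      = ∑ b ∈ hfin.toFinset, ∑ a ∈ hμ.toFinset, (μ a).toReal * ((κ a b).toReal * f b) := by
        rw [expectation_eq_sum _ f hfin.coe_toFinset.ge]
        simp only [toReal_bind_apply hS, sum_mul, mul_assoc]
    _ = ∑ a ∈ hμ.toFinset, (μ a).toReal * expectation (κ a) f := by
        rw [sum_comm]
        refine sum_congr rfl fun a ha => ?_
        rw [expectation_eq_sum _ f (hκU ha), mul_sum]
    _ = expectation μ fun a => expectation (κ a) f := (expectation_eq_sum _ _ hS).symm

end Expectation

/-! ### Drift bounds along the transcript -/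

section Transcript

variable {X : Type u} {G : Digraph X} {H : Finset (Classifier X)} {L : Learner X}

lemma Learner.isProper_iff_sum_weights_eq_one :
    L.IsProper H ↔ ∀ hist, ∑ i, L.weights H hist i = 1 :=
  forall_congr' fun hist => by
    rw [← sum_toReal_eq_one_iff, ← sum_coe_sort]
    rfl

lemma support_transcriptLaw_finite (tie : TieBreaking G) (A : Adversary X) (hL : L.IsProper H)
    (t : ℕ) : (transcriptLaw tie L A t).support.Finite := by
  induction t with
  | zero => simp [transcriptLaw, PMF.support_pure]
  | succ t ih =>
    rw [transcriptLaw, PMF.support_bind]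
    refine ih.biUnion fun τ _ => ?_
    rw [PMF.support_map]
    exact (H.finite_toSet.subset (hL _)).image _

lemma expectation_transcriptLaw_succ (tie : TieBreaking G) (A : Adversary X) (hL : L.IsProper H)
    (t : ℕ) (Z : List (Round X) → ℝ) :
    expectation (transcriptLaw tie L A (t + 1)) Z =
      expectation (transcriptLaw tie L A t) fun τ =>
        ∑ i, L.weights H (τ.map (Round.observe tie)) i * Z (⟨i.1, A τ⟩ :: τ) := by
  have hplay (hist : List (Observation X)) : (L hist).support.Finite :=
    H.finite_toSet.subset (hL hist)
  rw [transcriptLaw, expectation_bind (support_transcriptLaw_finite tie A hL t)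
    fun τ => PMF.support_map .. ▸ (hplay _).image _]
  congr! 2 with τ
  rw [PMF.map, expectation_bind (hplay _) fun h => by simp [PMF.support_pure]]
  simp only [Function.comp_apply, expectation_pure]
  rw [expectation_eq_sum _ _ (hL _), ← sum_coe_sort]
  rfl

theorem expectation_transcriptLaw_le (tie : TieBreaking G) (A : Adversary X) (hL : L.IsProper H)
    {Z : List (Round X) → ℝ} {c : ℝ}
    (hZ : ∀ τ, ∑ i, L.weights H (τ.map (Round.observe tie)) i * Z (⟨i.1, A τ⟩ :: τ) ≤ Z τ + c)
    (t : ℕ) : expectation (transcriptLaw tie L A t) Z ≤ Z [] + t * c := by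
  induction t with
  | zero => simp [transcriptLaw, expectation_pure]
  | succ t ih =>
    have hfin := support_transcriptLaw_finite tie A hL t
    calc expectation (transcriptLaw tie L A (t + 1)) Z
        ≤ expectation (transcriptLaw tie L A t) fun τ => Z τ + c := by
          rw [expectation_transcriptLaw_succ tie A hL]
          exact expectation_mono hfin hZ
      _ = expectation (transcriptLaw tie L A t) Z + c := expectation_add_const hfin Z c
      _ ≤ Z [] + ↑(t + 1) * c := by
          push_cast
          linarith

end Transcript

/-! ### The strategic loss and its estimator -/

section Loss

variable {X : Type u} {G : Digraph X}

lemma bestResponses_eq_empty_iff {h : Classifier X} {x : X} :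
    bestResponses G h x = ∅ ↔ h ∈ allNegative G x := by
  simp only [bestResponses, allNegative, Set.eq_empty_iff_forall_notMem, Set.mem_ofPred_eq, not_and,
    ← ne_eq, Int.units_ne_iff_eq_neg]

lemma apply_manipulate_eq_neg_one_iff (tie : TieBreaking G) {h : Classifier X} {x : X} :
    h (manipulate tie h x) = -1 ↔ h ∈ allNegative G x := by
  rw [← bestResponses_eq_empty_iff]
  by_cases hempty : bestResponses G h x = ∅
  · simpa [manipulate, hempty] using bestResponses_eq_empty_iff.1 hempty x (Or.inl rfl)
  · have hone : h (manipulate tie h x) = 1 := by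
      unfold manipulate
      split_ifs with hx
      · exact (hx.resolve_left hempty).2
      · exact (tie.pick_mem h x (Set.nonempty_iff_ne_empty.2 hempty)).2
    rw [hone]
    exact iff_of_false (by decide) hempty

open Classical in
/-- The strategic loss shifted by `1` on negative agents: what `estimator` estimates. -/
def shiftedLoss (G : Digraph X) (h : Classifier X) (a : Agent X) : ℝ :=
  if h ∈ allNegative G a.1 then ((a.2 : ℤ) : ℝ) else 0

lemma strategicLoss_eq_add_shiftedLoss (tie : TieBreaking G) (h : Classifier X) (a : Agent X) :
    strategicLoss tie h a = (if a.2 = -1 then 1 else 0) + shiftedLoss G h a := by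
  have hz := apply_manipulate_eq_neg_one_iff tie (h := h) (x := a.1)
  rw [strategicLoss, shiftedLoss, ← hz]
  generalize h (manipulate tie h a.1) = ŷ
  rcases Int.units_eq_one_or a.2 with hy | hy <;> rcases Int.units_eq_one_or ŷ with hŷ | hŷ <;>
    simp [hy, hŷ, show (1 : Label) ≠ -1 by decide, show (-1 : Label) ≠ 1 by decide]

lemma abs_label_le_one (y : Label) : |((y : ℤ) : ℝ)| ≤ 1 := by
  rcases Int.units_eq_one_or y with rfl | rfl <;> simp

lemma shiftedLoss_sub_shiftedLoss_le_one (G : Digraph X) (h g : Classifier X) (a : Agent X) :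
    shiftedLoss G h a - shiftedLoss G g a ≤ 1 := by
  have := abs_le.1 (abs_label_le_one a.2)
  unfold shiftedLoss
  split_ifs <;> linarith

lemma excessLoss_cons (tie : TieBreaking G) (h : Classifier X) (r : Round X)
    (τ : List (Round X)) :
    excessLoss tie h (r :: τ) =
      excessLoss tie h τ + (shiftedLoss G r.hyp r.agent - shiftedLoss G h r.agent) := by
  simp only [excessLoss, List.map_cons, List.sum_cons, strategicLoss_eq_add_shiftedLoss]
  ring

variable {H : Finset (Classifier X)} {p q : H → ℝ}

open Classical in
lemma allNegativeMass_eq_sum_filter (G : Digraph X) (p : H → ℝ) (x : X) :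
    allNegativeMass G H p x = ∑ i with i.1 ∈ allNegative G x, p i :=
  (sum_filter ..).symm

lemma allNegativeMass_pos (hp : ∀ i, 0 < p i) {x : X} {h : Classifier X} (hH : h ∈ H)
    (hh : h ∈ allNegative G x) : 0 < allNegativeMass G H p x := by
  classical
  rw [allNegativeMass_eq_sum_filter]
  exact sum_pos (fun i _ => hp i) ⟨⟨h, hH⟩, by simpa using hh⟩

lemma sum_mul_estimator_observe (tie : TieBreaking G) (hp : ∀ i, 0 < p i) (a : Agent X) (j : H) :
    ∑ i : H, p i * estimator G H p (Round.observe tie ⟨i, a⟩) j = shiftedLoss G j a := by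
  classical
  have hobserve (i : H) : estimator G H p (Round.observe tie ⟨i, a⟩) j =
      (if i.1 ∈ allNegative G a.1 then 1 else 0) * (if j.1 ∈ allNegative G a.1 then 1 else 0) *
        (((a.2 : ℤ) : ℝ) / allNegativeMass G H p a.1) :=
    estimator_observe tie H p ⟨i, a⟩ j
  have hmass : ∑ i : H, p i * (if i.1 ∈ allNegative G a.1 then 1 else 0) =
      allNegativeMass G H p a.1 := by
    simp only [mul_ite, mul_one, mul_zero, allNegativeMass]
  simp only [hobserve, ← mul_assoc, ← sum_mul, hmass, shiftedLoss]
  by_cases hj : j.1 ∈ allNegative G a.1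
  · rw [if_pos hj, if_pos hj, mul_one, mul_div_cancel₀ _ (allNegativeMass_pos hp j.2 hj).ne']
  · rw [if_neg hj, if_neg hj, mul_zero, zero_mul]

lemma estimator_observe_dotProduct (tie : TieBreaking G) (p v : H → ℝ) {r : Round X}
    (hr : r.hyp ∈ allNegative G r.agent.1) :
    estimator G H p (r.observe tie) ⬝ᵥ v =
      ((r.agent.2 : ℤ) : ℝ) / allNegativeMass G H p r.agent.1 *
        allNegativeMass G H v r.agent.1 := by
  classical
  rw [allNegativeMass.eq_def G H v, mul_sum]
  refine sum_congr rfl fun i _ => ?_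
  rw [estimator_observe]
  by_cases hi : i.1 ∈ allNegative G r.agent.1 <;> simp [hi, hr]

/-- The variance term of the stability of a round: a bound on how much the loss estimate of `r` can
decrease beyond the Bregman divergence, which vanishes together with the estimate. -/
def variancePenalty (G : Digraph X) (H : Finset (Classifier X)) (η : ℝ) (p : H → ℝ)
    (r : Round X) : ℝ :=
  open Classical in
  if r.hyp ∈ allNegative G r.agent.1 then 9 / 4 * η / allNegativeMass G H p r.agent.1 else 0

theorem estimator_stability (tie : TieBreaking G) {η ν : ℝ} (hη : 0 < η) (hν : 0 < ν)
    (hν' : ν ≤ 1 / 2) (hp : ∀ i, 0 < p i) (hq : ∀ i, 0 < q i) {r : Round X} (hr : r.hyp ∈ H) :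
    estimator G H p (r.observe tie) ⬝ᵥ (p - q) ≤
      regularizerBregman η ν q p + variancePenalty G H η p r := by
  classical
  by_cases hR : r.hyp ∈ allNegative G r.agent.1
  · rw [dotProduct_sub, estimator_observe_dotProduct tie p p hR,
      estimator_observe_dotProduct tie p q hR, ← mul_sub, variancePenalty, if_pos hR]
    simp only [allNegativeMass_eq_sum_filter]
    exact stability_le_regularizerBregman hη hν hν' hp hq
      ⟨⟨r.hyp, hr⟩, by simpa using hR⟩ (abs_label_le_one _)
  · have hzero : estimator G H p (r.observe tie) = 0 := by
      ext i
      simp [estimator_observe, hR]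
    rw [hzero, zero_dotProduct, variancePenalty, if_neg hR, add_zero]
    exact regularizerBregman_nonneg hη.le hν.le hp hq

lemma sum_mul_variancePenalty_le {η : ℝ} (hη : 0 ≤ η) (p : H → ℝ) (a : Agent X) :
    ∑ i : H, p i * variancePenalty G H η p ⟨i, a⟩ ≤ 9 / 4 * η := by
  classical
  simp only [variancePenalty, mul_ite, mul_zero, ← sum_filter, ← sum_mul,
    ← allNegativeMass_eq_sum_filter]
  rcases eq_or_ne (allNegativeMass G H p a.1) 0 with hP | hP
  · rw [hP, zero_mul]
    positivity
  · rw [mul_div_cancel₀ _ hP]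

end Loss

/-! ### Follow the regularized leader -/

section Learner

variable {X : Type u} {G : Digraph X} {H : Finset (Classifier X)} {L : Learner X} {ε η ν : ℝ}

lemma exists_learner_weights_eq {w : List (Observation X) → H → ℝ}
    (hw : ∀ hist, w hist ∈ stdSimplex ℝ H) :
    ∃ L : Learner X, ∀ hist, L.weights H hist = w hist := by
  classical
  refine ⟨fun hist => PMF.ofFinset
    (fun h => if hh : h ∈ H then ENNReal.ofReal (w hist ⟨h, hh⟩) else 0) H ?_ ?_, fun hist => ?_⟩
  · rw [← sum_coe_sort]
    simp only [coe_mem, dite_true, Subtype.coe_eta]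
    rw [← ENNReal.ofReal_sum_of_nonneg fun i _ => (hw hist).1 i, (hw hist).2, ENNReal.ofReal_one]
  · exact fun h hh => dif_neg hh
  · ext i
    simp [Learner.weights, (hw hist).1 i]

lemma Learner.IsFTRL.isProper (hL : L.IsFTRL G H ε η ν) : L.IsProper H :=
  Learner.isProper_iff_sum_weights_eq_one.2 fun hist => (hL hist).1.1.2

theorem exists_isFTRL (G : Digraph X) (H : Finset (Classifier X)) (hε : 0 < ε)
    (hne : (shrunkSimplex H ε).Nonempty) (η ν : ℝ) : ∃ L : Learner X, L.IsFTRL G H ε η ν := by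
  choose p hp hmin using exists_isMinOn_dotProduct_add_regularizer hε hne η ν
  let cumulative (hist : List (Observation X)) : H → ℝ :=
    hist.foldr (fun o c => c + estimator G H (p c) o) 0
  obtain ⟨L, hw⟩ := exists_learner_weights_eq (w := fun hist => p (cumulative hist))
    fun hist => (hp _).1
  have hcumulative (hist : List (Observation X)) :
      cumulativeEstimate G H L hist = cumulative hist := by
    induction hist with
    | nil => rfl
    | cons o hist ih => rw [cumulativeEstimate, ih, hw]; rfl
  refine ⟨L, fun hist => ?_⟩
  rw [hw, hcumulative]
  exact ⟨hp _, hmin _⟩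

/-- The regularized cumulative loss estimate, which follow-the-regularized-leader minimizes after
the history `hist`. -/
def ftrlObjective (G : Digraph X) (H : Finset (Classifier X)) (η ν : ℝ) (L : Learner X)
    (hist : List (Observation X)) (v : H → ℝ) : ℝ :=
  cumulativeEstimate G H L hist ⬝ᵥ v + regularizer η ν v

/-- How much larger the regularized cumulative loss estimate is at the comparator `u` than at the
weights of the learner: the learner's potential function. -/
def ftrlGap (G : Digraph X) (H : Finset (Classifier X)) (η ν : ℝ) (L : Learner X) (u : H → ℝ)
    (hist : List (Observation X)) : ℝ :=
  ftrlObjective G H η ν L hist u - ftrlObjective G H η ν L hist (L.weights H hist)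

lemma Learner.IsFTRL.isMinOn_ftrlObjective (hL : L.IsFTRL G H ε η ν)
    (hist : List (Observation X)) :
    IsMinOn (ftrlObjective G H η ν L hist) (shrunkSimplex H ε) (L.weights H hist) :=
  (hL hist).2

lemma Learner.IsFTRL.weights_pos (hL : L.IsFTRL G H ε η ν) (hε : 0 < ε)
    (hist : List (Observation X)) (i : H) : 0 < L.weights H hist i :=
  pos_of_mem_shrunkSimplex hε (hL hist).1 i

lemma Learner.IsFTRL.ftrlGap_nonneg (hL : L.IsFTRL G H ε η ν) {u : H → ℝ}
    (hu : u ∈ shrunkSimplex H ε) (hist : List (Observation X)) :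
    0 ≤ ftrlGap G H η ν L u hist :=
  sub_nonneg.2 (hL.isMinOn_ftrlObjective hist hu)

lemma Learner.IsFTRL.ftrlGap_nil_le (hL : L.IsFTRL G H ε η ν) (hε : 0 < ε) (hη : 0 ≤ η)
    (hν : 0 ≤ ν) {u : H → ℝ} (hu : u ∈ shrunkSimplex H ε) :
    ftrlGap G H η ν L u [] ≤
      1 / η * Real.log H.card + 1 / ν * (H.card * Real.log (1 / ε)) := by
  simpa [ftrlGap, ftrlObjective, cumulativeEstimate] using
    regularizer_sub_regularizer_le hε hη hν (hL []).1.1 hu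

lemma ftrlObjective_cons (o : Observation X) (hist : List (Observation X)) (v : H → ℝ) :
    ftrlObjective G H η ν L (o :: hist) v =
      ftrlObjective G H η ν L hist v + estimator G H (L.weights H hist) o ⬝ᵥ v := by
  rw [ftrlObjective, ftrlObjective, cumulativeEstimate, add_dotProduct]
  ring

theorem Learner.IsFTRL.ftrlGap_cons_le (hL : L.IsFTRL G H ε η ν) (hε : 0 < ε) (hη : 0 < η)
    (hν : 0 < ν) (hν' : ν ≤ 1 / 2) (tie : TieBreaking G) (u : H → ℝ)
    (hist : List (Observation X)) {r : Round X} (hr : r.hyp ∈ H) :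
    ftrlGap G H η ν L u (r.observe tie :: hist) ≤
      ftrlGap G H η ν L u hist +
        estimator G H (L.weights H hist) (r.observe tie) ⬝ᵥ (u - L.weights H hist) +
        variancePenalty G H η (L.weights H hist) r := by
  set p := L.weights H hist
  set q := L.weights H (r.observe tie :: hist) with hq
  have hgrowth : ftrlObjective G H η ν L hist p + regularizerBregman η ν q p ≤
      ftrlObjective G H η ν L hist q :=
    add_regularizerBregman_le_of_isMinOn (convex_shrunkSimplex ε) (hL hist).1 (hL _).1
      (fun i => (hL.weights_pos hε hist i).ne') (hL.isMinOn_ftrlObjective hist)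
  have hstability := estimator_stability tie hη hν hν' (hL.weights_pos hε hist)
    (hL.weights_pos hε (r.observe tie :: hist)) hr
  rw [dotProduct_sub] at hstability ⊢
  rw [ftrlGap, ftrlGap, ftrlObjective_cons, ftrlObjective_cons, ← hq]
  linarith

theorem Learner.IsFTRL.sum_mul_ftrlGap_cons_le (hL : L.IsFTRL G H ε η ν) (hε : 0 < ε)
    (hη : 0 < η) (hν : 0 < ν) (hν' : ν ≤ 1 / 2) (tie : TieBreaking G) (u : H → ℝ)
    (hist : List (Observation X)) (a : Agent X) :
    ∑ i : H, L.weights H hist i * ftrlGap G H η ν L u (Round.observe tie ⟨i, a⟩ :: hist) ≤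
      ftrlGap G H η ν L u hist +
        (fun j : H => shiftedLoss G j a) ⬝ᵥ (u - L.weights H hist) + 9 / 4 * η := by
  set p := L.weights H hist
  have hunbiased (v : H → ℝ) :
      ∑ i : H, p i * (estimator G H p (Round.observe tie ⟨i, a⟩) ⬝ᵥ v) =
        (fun j : H => shiftedLoss G j a) ⬝ᵥ v := by
    simp only [dotProduct, mul_sum, ← mul_assoc]
    rw [sum_comm]
    simp only [← sum_mul, p, sum_mul_estimator_observe tie (hL.weights_pos hε hist)]
  calc ∑ i : H, p i * ftrlGap G H η ν L u (Round.observe tie ⟨i, a⟩ :: hist)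
      ≤ ∑ i : H, p i * (ftrlGap G H η ν L u hist +
          estimator G H p (Round.observe tie ⟨i, a⟩) ⬝ᵥ (u - p) +
          variancePenalty G H η p ⟨i, a⟩) := by
        gcongr with i
        · exact (hL.weights_pos hε hist i).le
        · exact hL.ftrlGap_cons_le hε hη hν hν' tie u hist i.2
    _ = ftrlGap G H η ν L u hist + (fun j : H => shiftedLoss G j a) ⬝ᵥ (u - p) +
          ∑ i : H, p i * variancePenalty G H η p ⟨i, a⟩ := by
        simp only [mul_add, sum_add_distrib, hunbiased, ← sum_mul, p, (hL hist).1.1.2, one_mul]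
    _ ≤ _ := by
        gcongr
        exact sum_mul_variancePenalty_le hη.le p a

end Learner

/-! ### The regret bound -/

section Regret

variable {X : Type u} {G : Digraph X} {H : Finset (Classifier X)} {L : Learner X} {ε η ν : ℝ}

lemma sum_weights_mul_excessLoss_cons (hL : L.IsProper H) (tie : TieBreaking G)
    (hist : List (Observation X)) (h : Classifier X) (a : Agent X) (τ : List (Round X)) :
    ∑ i : H, L.weights H hist i * excessLoss tie h (⟨i, a⟩ :: τ) =
      excessLoss tie h τ + (fun j : H => shiftedLoss G j a) ⬝ᵥ L.weights H hist -
        shiftedLoss G h a := by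
  simp only [excessLoss_cons, mul_add, mul_sub, sum_add_distrib, sum_sub_distrib, ← sum_mul,
    Learner.isProper_iff_sum_weights_eq_one.1 hL, dotProduct, mul_comm (shiftedLoss G _ a)]
  ring

open Classical in
theorem Learner.IsFTRL.sum_mul_excessLoss_add_ftrlGap_le (hL : L.IsFTRL G H ε η ν) (hε : 0 < ε)
    (hη : 0 < η) (hν : 0 < ν) (hν' : ν ≤ 1 / 2) (tie : TieBreaking G) (k : H) (a : Agent X)
    (hist : List (Observation X)) (τ : List (Round X)) :
    ∑ i : H, L.weights H hist i * (excessLoss tie k (⟨i, a⟩ :: τ) +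
        ftrlGap G H η ν L (smoothedVertex ε k) (Round.observe tie ⟨i, a⟩ :: hist)) ≤
      excessLoss tie k τ + ftrlGap G H η ν L (smoothedVertex ε k) hist +
        (9 / 4 * η + H.card * ε) := by
  have hgap := hL.sum_mul_ftrlGap_cons_le hε hη hν hν' tie (smoothedVertex ε k) hist a
  have hcomparator := dotProduct_smoothedVertex_le hε.le (c := fun j : H => shiftedLoss G j a)
    (k := k) fun i => shiftedLoss_sub_shiftedLoss_le_one G i k a
  rw [dotProduct_sub] at hgap
  rw [Fintype.card_coe] at hcomparator
  simp only [mul_add, sum_add_distrib, sum_weights_mul_excessLoss_cons hL.isProper]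
  linarith

theorem Learner.IsFTRL.expectation_excessLoss_le (hL : L.IsFTRL G H ε η ν) (hε : 0 < ε)
    (hε' : H.card * ε ≤ 1) (hη : 0 < η) (hν : 0 < ν) (hν' : ν ≤ 1 / 2) (tie : TieBreaking G)
    (A : Adversary X) (T : ℕ) {h : Classifier X} (hh : h ∈ H) :
    expectation (transcriptLaw tie L A T) (excessLoss tie h) ≤
      1 / η * Real.log H.card + 1 / ν * (H.card * Real.log (1 / ε)) +
        T * (9 / 4 * η + H.card * ε) := by
  classical
  set u := smoothedVertex ε (⟨h, hh⟩ : H)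
  have hu : u ∈ shrunkSimplex H ε :=
    smoothedVertex_mem_shrunkSimplex hε.le (by rwa [Fintype.card_coe]) _
  let potential (τ : List (Round X)) : ℝ :=
    excessLoss tie h τ + ftrlGap G H η ν L u (τ.map (Round.observe tie))
  calc expectation (transcriptLaw tie L A T) (excessLoss tie h)
      ≤ expectation (transcriptLaw tie L A T) potential :=
        expectation_mono (support_transcriptLaw_finite tie A hL.isProper T) fun τ =>
          le_add_of_nonneg_right (hL.ftrlGap_nonneg hu _)
    _ ≤ potential [] + T * (9 / 4 * η + H.card * ε) :=
        expectation_transcriptLaw_le tie A hL.isProper (fun τ =>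
          hL.sum_mul_excessLoss_add_ftrlGap_le hε hη hν hν' tie ⟨h, hh⟩ (A τ) _ τ) T
    _ ≤ _ := by
        gcongr
        simpa [potential, excessLoss] using hL.ftrlGap_nil_le hε hη.le hν.le hu

lemma expectation_excessLoss_nonpos_of_isProper_singleton {h : Classifier X}
    (hL : L.IsProper {h}) (tie : TieBreaking G) (A : Adversary X) (T : ℕ) :
    expectation (transcriptLaw tie L A T) (excessLoss tie h) ≤ 0 := by
  refine (expectation_transcriptLaw_le tie A hL (Z := excessLoss tie h) (c := 0)
    (fun τ => ?_) T).trans_eq (by simp [excessLoss])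
  have hplay (i : ({h} : Finset (Classifier X))) : i.1 = h := mem_singleton.1 i.2
  simp only [hplay, excessLoss_cons, sub_self, add_zero, ← sum_mul,
    Learner.isProper_iff_sum_weights_eq_one.1 hL, one_mul, le_refl]

lemma one_le_mul_log_mul {n T : ℝ} (hn : 2 ≤ n) (hT : 1 ≤ T) : 1 ≤ n * Real.log (n * T) := by
  have hlog : Real.log 2 ≤ Real.log (n * T) := Real.log_le_log two_pos (by nlinarith)
  nlinarith [Real.log_two_gt_d9]

lemma mul_one_div_mul_le_one {n T : ℝ} (hn : 0 < n) (hT : 1 ≤ T) : n * (1 / (n * T)) ≤ 1 := by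
  rw [← div_eq_mul_one_div, div_mul_cancel_left₀ hn.ne']
  exact inv_le_one_of_one_le₀ hT

lemma tuned_bound_le {n T : ℝ} (hn : 2 ≤ n) (hT : 1 ≤ T) :
    1 / √(Real.log n / T) * Real.log n + 1 / (1 / 16) * (n * Real.log (1 / (1 / (n * T)))) +
        T * (9 / 4 * √(Real.log n / T) + n * (1 / (n * T))) ≤
      17 * (√(T * Real.log n) + n * Real.log (n * T)) := by
  have hlog : 0 < Real.log n := Real.log_pos (by linarith)
  have hT₀ : 0 < T := by linarith
  have hentropy : 1 / √(Real.log n / T) * Real.log n = √(T * Real.log n) := by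
    rw [Real.sqrt_div hlog.le, one_div_div, div_mul_eq_mul_div, mul_div_assoc, Real.div_sqrt,
      Real.sqrt_mul hT₀.le]
  have hvariance : T * √(Real.log n / T) = √(T * Real.log n) := by
    rw [Real.sqrt_div hlog.le, mul_div_left_comm, Real.div_sqrt, Real.sqrt_mul hT₀.le, mul_comm]
  have hsmoothing : T * (n * (1 / (n * T))) = 1 := by field_simp
  rw [mul_add T, mul_left_comm T, hsmoothing, hvariance, hentropy, one_div_one_div, one_div_one_div]
  linarith [one_le_mul_log_mul hn hT, Real.sqrt_nonneg (T * Real.log n)]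

theorem Learner.IsFTRL.expectedRegret_le {T : ℕ} (hT : 1 ≤ T)
    (hL : L.IsFTRL G H (1 / (H.card * T)) √(Real.log H.card / T) (1 / 16)) (hH : H.Nonempty)
    (tie : TieBreaking G) (A : Adversary X) :
    expectedRegret tie H hH T L A ≤
      17 * (√(T * Real.log H.card) + H.card * Real.log (H.card * T)) := by
  have hT' : (1 : ℝ) ≤ T := by exact_mod_cast hT
  have hn : (0 : ℝ) < H.card := by exact_mod_cast hH.card_pos
  refine sup'_le hH _ fun h hh => ?_
  rcases (Nat.succ_le_of_lt hH.card_pos).eq_or_lt with hone | htwo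
  · obtain rfl : H = {h} := (card_eq_one.1 hone.symm).elim fun g hg => by
      rw [hg, mem_singleton] at hh
      rw [hg, hh]
    refine (expectation_excessLoss_nonpos_of_isProper_singleton hL.isProper tie A T).trans ?_
    simp [Real.log_natCast_nonneg]
  · have hlog : 0 < Real.log H.card := Real.log_pos (by exact_mod_cast htwo)
    refine (hL.expectation_excessLoss_le (by positivity) (mul_one_div_mul_le_one hn hT')
      (by positivity) (by norm_num) (by norm_num) tie A T hh).trans ?_
    exact tuned_bound_le (by exact_mod_cast htwo) hT'

end Regret

end StrategicClassification

end

theorem mainTheorem2 :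
    ∃ C : ℝ, 0 < C ∧
      ∀ (X : Type u) (G : Digraph X)
        (H : Finset (StrategicClassification.Classifier X)) (hH : H.Nonempty)
        (T : ℕ), 1 ≤ T →
        ∃ L : StrategicClassification.Learner X,
          L.IsProper H ∧
          L.IsFTRL G H (1 / ((H.card : ℝ) * T)) (Real.sqrt (Real.log H.card / T)) (1 / 16) ∧
          ∀ (tie : StrategicClassification.TieBreaking G)
            (A : StrategicClassification.Adversary X),
            StrategicClassification.expectedRegret tie H hH T L A ≤
              C * (Real.sqrt (T * Real.log H.card) +
                H.card * Real.log ((H.card : ℝ) * T)) := by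
  refine ⟨17, by norm_num, fun X G H hH T hT => ?_⟩
  have hn : (0 : ℝ) < H.card := by exact_mod_cast hH.card_pos
  have hT' : (1 : ℝ) ≤ T := by exact_mod_cast hT
  have hε : 0 < 1 / ((H.card : ℝ) * T) := by positivity
  have : Nonempty H := hH.to_subtype
  have hsimplex := StrategicClassification.shrunkSimplex_nonempty (ι := H) hε.le <| by
    simpa only [Fintype.card_coe] using StrategicClassification.mul_one_div_mul_le_one hn hT'
  obtain ⟨L, hL⟩ := StrategicClassification.exists_isFTRL G H hε hsimplex
    (Real.sqrt (Real.log H.card / T)) (1 / 16)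
  exact ⟨L, hL.isProper, hL, hL.expectedRegret_le hT hH⟩
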